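/- Let $A$ be a finite alphabet, let $A^*$ be the free monoid on $A$, and let $\widehat{A^*}$ be the free profinite monoid on $A$, with $\overline{L}$ denoting the topological closure in $\widehat{A^*}$ of a language $L\subseteq A^*$. For a rational language $L\subseteq A^*$ let $M(L)$ be its (finite) syntactic monoid and let $\hat\eta_L\colon\widehat{A^*}\to M(L)$ be the unique continuous homomorphism extending the syntactic homomorphism $A^*\to M(L)$. A prefix code is a nonempty set $X$ of nonempty words over $A$ such that no element of $X$ is a proper prefix of another element of $X$; it is $F$-maximal, for $F\subseteq A^*$, if $X\subseteq F$ and $X$ is not properly contained in any other prefix code contained in $F$. An element $u\in\widehat{A^*}$ is forbidden in $Y\subseteq\widehat{A^*}$ if no element of $Y$ is of the form $xuy$ with $x,y\in\widehat{A^*}$. A subgroup of a monoid is a subsemigroup that is a group, and a maximal subgroup is a subgroup that is maximal for inclusion. Let $F\subseteq A^*$ be factorial, that is, closed under taking factors of words. Suppose that $Z\subseteq A^*$ is a rational prefix code and that $X=Z\cap F$ is a rational $F$-maximal prefix code. Let $H$ be a maximal subgroup of $\widehat{A^*}$ contained in $\overline{F}$, and suppose that the elements of $H$ are forbidden in $\overline{Z}$.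 Let $H_X$ be the maximal subgroup of $M(X^*)$ containing $\hat\eta_{X^*}(H)$, and let $H_Z$ be the maximal subgroup of $M(Z^*)$ containing $\hat\eta_{Z^*}(H)$. Then there is an injective homomorphism $\alpha\colon H_X\to H_Z$ such that $\alpha(\hat\eta_{X^*}(h))=\hat\eta_{Z^*}(h)$ for every $h\in H$. -/

import Mathlib

open scoped Computability

universe u

/-! ### Languages, codes -/

/-- A set of words is factorial if it contains every factor of each of its elements. -/
def IsFactorial {A : Type u} (F : Language A) : Prop :=
  ∀ w ∈ F, ∀ v : List A, v <:+: w → v ∈ F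

/-- A prefix code: a nonempty subset `X` of `A⁺` with `X ∩ XA⁺ = ∅`. -/
structure IsPrefixCode {A : Type u} (X : Language A) : Prop where
  nonempty : ∃ w, w ∈ X
  nil_notMem : [] ∉ X
  append_notMem : ∀ x ∈ X, ∀ w : List A, w ≠ [] → x ++ w ∉ X

/-- An `F`-maximal prefix code: a prefix code contained in `F` and not properly contained in any
other prefix code contained in `F`. -/
def IsMaximalPrefixCodeIn {A : Type u} (F X : Language A) : Prop :=
  Maximal (fun Y : Language A => IsPrefixCode Y ∧ Y ≤ F) X

/-- The Kleene star of a regular language is regular. -/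
theorem Language.IsRegular.kstar' {A : Type u} {L : Language A} (h : L.IsRegular) :
    (L∗).IsRegular := by
  classical
  apply Language.IsRegular.of_finite_range_leftQuotient
  have hfin := h.finite_range_leftQuotient
  let g : Prop × Set (Language A) → Language A := fun p =>
    {y : List A | (p.1 ∧ y ∈ L∗) ∨ ∃ Q ∈ p.2, ∃ y₁ ∈ Q, ∃ y₂ ∈ L∗, y = y₁ ++ y₂}
  have hS : ((Set.univ : Set Prop) ×ˢ (𝒫 (Set.range L.leftQuotient))).Finite :=
    Set.finite_univ.prod hfin.finite_subsets
  refine (hS.image g).subset ?_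
  rintro _ ⟨w, rfl⟩
  refine ⟨(w ∈ L∗, {Q | ∃ a v : List A, w = a ++ v ∧ a ∈ L∗ ∧ Q = L.leftQuotient v}),
    ⟨Set.mem_univ _, ?_⟩, ?_⟩
  · rintro Q ⟨a, v, -, -, rfl⟩
    exact ⟨v, rfl⟩
  · have happ : ∀ a b : List A, a ∈ L∗ → b ∈ L∗ → a ++ b ∈ L∗ := by
      rintro _ _ ⟨S, rfl, hS⟩ ⟨T, rfl, hT⟩
      refine ⟨S ++ T, by simp, ?_⟩
      intro y hy
      rcases List.mem_append.1 hy with hy | hy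
      · exact hS y hy
      · exact hT y hy
    have hone : ∀ a : List A, a ∈ L → a ∈ L∗ := fun a ha =>
      ⟨[a], by simp, by simpa using ha⟩
    have key : ∀ (S : List (List A)), (∀ y ∈ S, y ∈ L) → ∀ w y : List A, w ++ y = S.flatten →
        (w ∈ L∗ ∧ y ∈ L∗) ∨ ∃ a v y₁ y₂ : List A, w = a ++ v ∧ a ∈ L∗ ∧ v ++ y₁ ∈ L ∧
          y₂ ∈ L∗ ∧ y = y₁ ++ y₂ := by
      intro S
      induction S with
      | nil =>
        intro _ w y hwy
        simp only [List.flatten_nil, List.append_eq_nil_iff] at hwy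
        obtain ⟨rfl, rfl⟩ := hwy
        exact Or.inl ⟨⟨[], by simp, by simp⟩, ⟨[], by simp, by simp⟩⟩
      | cons s S ih =>
        intro hS w y hwy
        rw [List.flatten_cons] at hwy
        have hsS : ∀ y ∈ S, y ∈ L := fun y hy => hS y (List.mem_cons_of_mem _ hy)
        have hs : s ∈ L := hS s List.mem_cons_self
        rcases List.append_eq_append_iff.1 hwy with ⟨t, h1, h2⟩ | ⟨t, h1, h2⟩
        · right
          exact ⟨[], w, t, S.flatten, by simp, ⟨[], by simp, by simp⟩, h1 ▸ hs,
            ⟨S, rfl, hsS⟩, h2⟩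
        · rcases ih hsS t y h2.symm with ⟨h3, h4⟩ | ⟨a, v, y₁, y₂, h3, h4, h5, h6, h7⟩
          · left
            exact ⟨h1 ▸ happ _ _ (hone _ hs) h3, h4⟩
          · right
            exact ⟨s ++ a, v, y₁, y₂, by rw [h1, h3, List.append_assoc],
              happ _ _ (hone _ hs) h4, h5, h6, h7⟩
    apply Language.ext
    intro y
    constructor
    · rintro (⟨h1, h2⟩ | ⟨Q, ⟨a, v, h1, h2, rfl⟩, y₁, h3, y₂, h4, rfl⟩)
      · exact happ _ _ h1 h2
      · have h5 : w ++ (y₁ ++ y₂) = a ++ ((v ++ y₁) ++ y₂) := by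
          rw [h1]
          simp
        change w ++ (y₁ ++ y₂) ∈ L∗
        rw [h5]
        exact happ _ _ h2 (happ _ _ (hone _ h3) h4)
    · rintro ⟨S, h1, h2⟩
      rcases key S h2 w y h1 with h3 | ⟨a, v, y₁, y₂, h3, h4, h5, h6, h7⟩
      · exact Or.inl h3
      · exact Or.inr ⟨_, ⟨a, v, h3, h4, rfl⟩, y₁, h5, y₂, h6, h7⟩

/-! ### The syntactic monoid -/

/-- The syntactic congruence of `L`: two words are related if they have the same contexts in `L`. -/
def syntacticCon {A : Type u} (L : Language A) : Con (FreeMonoid A) where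
  r u v := ∀ x y : FreeMonoid A,
    FreeMonoid.toList (x * u * y) ∈ L ↔ FreeMonoid.toList (x * v * y) ∈ L
  iseqv :=
    { refl := fun _ _ _ => Iff.rfl
      symm := fun h x y => (h x y).symm
      trans := fun h k x y => (h x y).trans (k x y) }
  mul' := by
    intro a b c d hab hcd x y
    have h1 := hab x (c * y)
    have h2 := hcd (x * b) y
    simp only [mul_assoc] at h1 h2 ⊢
    exact h1.trans h2

/-- The syntactic monoid `M(L)`. -/
abbrev SyntacticMonoid {A : Type u} (L : Language A) : Type u := (syntacticCon L).Quotient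

/-- The syntactic homomorphism `η_L : A* → M(L)`. -/
def syntacticHom {A : Type u} (L : Language A) : FreeMonoid A →* SyntacticMonoid L :=
  (syntacticCon L).mk'

/-- The syntactic monoid of a regular language is finite. -/
theorem finite_syntacticMonoid {A : Type u} {L : Language A} (h : L.IsRegular) :
    Finite (SyntacticMonoid L) := by
  obtain ⟨σ, _, M, rfl⟩ := h
  let f : FreeMonoid A → (σ → σ) := fun w s => M.evalFrom s (FreeMonoid.toList w)
  have hf : ∀ u v, f u = f v → syntacticCon M.accepts u v := by
    intro u v huv x y
    have h1 : ∀ s, M.evalFrom s (FreeMonoid.toList u) = M.evalFrom s (FreeMonoid.toList v) :=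
      fun s => congrFun huv s
    simp only [FreeMonoid.toList_mul, DFA.mem_accepts, DFA.eval, DFA.evalFrom_of_append, h1]
  have hinj : Function.Injective (fun q : SyntacticMonoid M.accepts => f (Quotient.out q)) := by
    intro p q hpq
    have h2 := hf _ _ hpq
    rw [← Quotient.out_eq p, ← Quotient.out_eq q]
    exact Quotient.sound h2
  exact Finite.of_injective _ hinj

/-! ### The free profinite monoid

The free profinite monoid on `A` is the projective limit of the finite quotient monoids of the free
monoid `A*`, each of them being discrete. -/

/-- The congruences of finite index on `A*`. -/
abbrev FinCon (A : Type u) : Type u := {c : Con (FreeMonoid A) // Finite c.Quotient}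

/-- The finite quotient of `A*` by a congruence of finite index. -/
def FinCon.Quo {A : Type u} (c : FinCon A) : Type u := c.1.Quotient

instance {A : Type u} (c : FinCon A) : Monoid c.Quo := inferInstanceAs (Monoid c.1.Quotient)

instance {A : Type u} (c : FinCon A) : Finite c.Quo := c.2

instance {A : Type u} (c : FinCon A) : TopologicalSpace c.Quo := ⊥

instance {A : Type u} (c : FinCon A) : DiscreteTopology c.Quo := ⟨rfl⟩

/-- The projection of `A*` onto a finite quotient. -/
def FinCon.mk {A : Type u} (c : FinCon A) : FreeMonoid A →* c.Quo := c.1.mk'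

/-- The canonical homomorphism between two finite quotients of `A*`. -/
def FinCon.trans {A : Type u} {c d : FinCon A} (h : c.1 ≤ d.1) : c.Quo →* d.Quo := Con.map c.1 d.1 h

/-- The free profinite monoid as the submonoid of compatible families in the product of all finite
quotients of `A*`. -/
def freeProfiniteSubmonoid (A : Type u) : Submonoid (∀ c : FinCon A, c.Quo) where
  carrier := {x | ∀ (c d : FinCon A) (h : c.1 ≤ d.1), FinCon.trans h (x c) = x d}
  one_mem' := fun _ _ _ => map_one _
  mul_mem' := by
    intro x y hx hy c d h
    simp only [Pi.mul_apply, map_mul, hx c d h, hy c d h]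

/-- The free profinite monoid on `A`, with the product multiplication and the subspace topology of
the product topology. -/
abbrev FreeProfiniteMonoid (A : Type u) : Type u := freeProfiniteSubmonoid A

namespace FreeProfiniteMonoid

/-- The embedding of words into pseudowords. -/
def of {A : Type u} : FreeMonoid A →* FreeProfiniteMonoid A where
  toFun w := ⟨fun c => c.mk w, fun _ _ _ => rfl⟩
  map_one' := Subtype.ext (funext fun c => map_one c.mk)
  map_mul' u v := Subtype.ext (funext fun c => map_mul c.mk u v)

/-- The projection of the free profinite monoid onto a finite quotient of `A*`. -/
def proj {A : Type u} (c : FinCon A) : FreeProfiniteMonoid A →* c.Quo where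
  toFun x := x.1 c
  map_one' := rfl
  map_mul' _ _ := rfl

theorem continuous_proj {A : Type u} (c : FinCon A) : Continuous (proj c) :=
  (continuous_apply c).comp continuous_subtype_val

/-- The words form a dense subset of the free profinite monoid. -/
theorem denseRange_of {A : Type u} : DenseRange (of : FreeMonoid A → FreeProfiniteMonoid A) := by
  classical
  intro x
  rw [mem_closure_iff]
  rintro U ⟨V, hV, rfl⟩ hx
  obtain ⟨I, t, ht, hsub⟩ := isOpen_pi_iff.1 hV x.1 hx
  -- a common refinement of the finitely many congruences in `I`
  let φ : FreeMonoid A →* (∀ c : I, c.1.Quo) := MonoidHom.pi fun c : I => c.1.mk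
  have hfin : Finite (Con.ker φ).Quotient :=
    Finite.of_injective (Con.kerLift φ) (Con.kerLift_injective φ)
  let d : FinCon A := ⟨Con.ker φ, hfin⟩
  have hd : ∀ c ∈ I, d.1 ≤ c.1 := by
    intro c hc u v huv
    have h1 : φ u = φ v := huv
    have h2 : c.mk u = c.mk v := congrFun h1 ⟨c, hc⟩
    exact (Con.eq c.1).1 h2
  obtain ⟨w, hw⟩ : ∃ w, d.mk w = x.1 d := Con.mk'_surjective (x.1 d)
  refine ⟨of w, hsub ?_, w, rfl⟩
  intro c hc
  have h3 : c.mk w = x.1 c := by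
    rw [← x.2 d c (hd c hc), ← hw]
    rfl
  change c.mk w ∈ t c
  rw [h3]
  exact (ht c hc).2

end FreeProfiniteMonoid

/-- The congruence of finite index attached to a regular language. -/
def syntacticFinCon {A : Type u} {L : Language A} (h : L.IsRegular) : FinCon A :=
  ⟨syntacticCon L, finite_syntacticMonoid h⟩

/-- The extension of the syntactic homomorphism of a regular language `L` to a homomorphism from
the free profinite monoid to `M(L)`. -/
def syntacticHat {A : Type u} {L : Language A} (h : L.IsRegular) :
    FreeProfiniteMonoid A →* SyntacticMonoid L :=
  FreeProfiniteMonoid.proj (syntacticFinCon h)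

/-- `syntacticHat h` is the unique continuous homomorphism (for the discrete topology on the
syntactic monoid) that extends the syntactic homomorphism. -/
theorem syntacticHat_unique {A : Type u} {L : Language A} (h : L.IsRegular)
    (ψ : FreeProfiniteMonoid A →* SyntacticMonoid L) :
    (@Continuous _ _ _ ⊥ ψ ∧ ∀ w, ψ (FreeProfiniteMonoid.of w) = syntacticHom L w) ↔
      ψ = syntacticHat h := by
  let _ : TopologicalSpace (SyntacticMonoid L) := ⊥
  have _ : DiscreteTopology (SyntacticMonoid L) := ⟨rfl⟩
  have hc : Continuous (syntacticHat h) := FreeProfiniteMonoid.continuous_proj (syntacticFinCon h)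
  constructor
  · rintro ⟨h1, h2⟩
    apply DFunLike.coe_injective
    refine FreeProfiniteMonoid.denseRange_of.equalizer h1 hc ?_
    funext w
    exact h2 w
  · rintro rfl
    exact ⟨hc, fun w => rfl⟩

/-! ### Pseudowords and sets of pseudowords -/

/-- The topological closure in the free profinite monoid of a set of words. -/
def profiniteClosure {A : Type u} (L : Language A) : Set (FreeProfiniteMonoid A) :=
  closure {x | ∃ w ∈ L, x = FreeProfiniteMonoid.of (FreeMonoid.ofList w)}

/-- An element `u` of a monoid is forbidden in `Y` if it is not a factor of an element of `Y`. -/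
def IsForbiddenIn {M : Type u} [Monoid M] (u : M) (Y : Set M) : Prop :=
  ∀ a b : M, a * u * b ∉ Y

/-! ### Maximal subgroups of a monoid -/

/-- A subsemigroup of a monoid that is a group. -/
def IsSubgroupOfMonoid {M : Type u} [Monoid M] (S : Subsemigroup M) : Prop :=
  ∃ e ∈ S, (∀ x ∈ S, e * x = x ∧ x * e = x) ∧ ∀ x ∈ S, ∃ y ∈ S, x * y = e ∧ y * x = e

/-- A maximal subgroup of a monoid, with respect to inclusion. -/
def IsMaximalSubgroup {M : Type u} [Monoid M] (S : Subsemigroup M) : Prop :=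
  Maximal IsSubgroupOfMonoid S

/-- The image of a subgroup under a homomorphism of monoids is a subgroup. -/
theorem IsSubgroupOfMonoid.map {M N : Type u} [Monoid M] [Monoid N] (f : M →* N)
    {S : Subsemigroup M} (hS : IsSubgroupOfMonoid S) :
    IsSubgroupOfMonoid (S.map (f : M →ₙ* N)) := by
  obtain ⟨e, he, h1, h2⟩ := hS
  refine ⟨f e, ⟨e, he, rfl⟩, ?_, ?_⟩
  · rintro _ ⟨x, hx, rfl⟩
    exact ⟨by simp [← map_mul, (h1 x hx).1], by simp [← map_mul, (h1 x hx).2]⟩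
  · rintro _ ⟨x, hx, rfl⟩
    obtain ⟨y, hy, h3, h4⟩ := h2 x hx
    exact ⟨f y, ⟨y, hy, rfl⟩, by simp [← map_mul, h3], by simp [← map_mul, h4]⟩

/-- Every subgroup of a monoid is contained in exactly one maximal subgroup. -/
theorem IsSubgroupOfMonoid.existsUnique_maximal {M : Type u} [Monoid M] {S : Subsemigroup M}
    (hS : IsSubgroupOfMonoid S) : ∃! T : Subsemigroup M, IsMaximalSubgroup T ∧ S ≤ T := by
  obtain ⟨e, he, h1, h2⟩ := hS
  have hee : e * e = e := (h1 e he).1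
  -- the group of units of the local monoid at `e`
  let G : Subsemigroup M :=
    { carrier := {x | (e * x = x ∧ x * e = x) ∧ ∃ y, (e * y = y ∧ y * e = y) ∧
        x * y = e ∧ y * x = e}
      mul_mem' := by
        rintro a b ⟨⟨a1, a2⟩, a', ⟨a3, a4⟩, a5, a6⟩ ⟨⟨b1, b2⟩, b', ⟨b3, b4⟩, b5, b6⟩
        refine ⟨⟨by rw [← mul_assoc, a1], by rw [mul_assoc, b2]⟩, b' * a',
          ⟨by rw [← mul_assoc, b3], by rw [mul_assoc, a4]⟩, ?_, ?_⟩
        · rw [mul_assoc, ← mul_assoc b, b5, a3, a5]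
        · rw [mul_assoc, ← mul_assoc a', a6, b1, b6] }
  have hG : IsSubgroupOfMonoid G := by
    refine ⟨e, ⟨⟨hee, hee⟩, e, ⟨hee, hee⟩, hee, hee⟩, fun x hx => hx.1, ?_⟩
    rintro x ⟨hx, y, hy, h3, h4⟩
    exact ⟨y, ⟨hy, x, hx, h4, h3⟩, h3, h4⟩
  -- it contains every subgroup containing `e`
  have hmax : ∀ T : Subsemigroup M, IsSubgroupOfMonoid T → e ∈ T → T ≤ G := by
    rintro T ⟨f, hf, k1, k2⟩ heT
    have hef : e = f := by
      obtain ⟨y, hy, k3, -⟩ := k2 e heT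
      calc e = e * f := ((k1 e heT).2).symm
        _ = e * (e * y) := by rw [k3]
        _ = f := by rw [← mul_assoc, hee, k3]
    subst hef
    intro x hx
    obtain ⟨y, hy, k3, k4⟩ := k2 x hx
    exact ⟨k1 x hx, y, k1 y hy, k3, k4⟩
  refine ⟨G, ⟨⟨hG, fun T hT hGT => hmax T hT (hGT ?_)⟩, hmax S ⟨e, he, h1, h2⟩ he⟩, ?_⟩
  · exact ⟨⟨hee, hee⟩, e, ⟨hee, hee⟩, hee, hee⟩
  · rintro T ⟨hT, hST⟩
    have hTG := hmax T hT.1 (hST he)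
    exact le_antisymm hTG (hT.2 hG hTG)

/-! ### Prefix codes -/

/-! Let `u` be the identity of `H`, with images `e` in `M(X∗)` and `f` in `M(Z∗)`. The homomorphism
sends `g` in `HX` to `f * η(v) * f`, where `v` is any word of class `g` in `M(X∗)` and `η` is the
syntactic homomorphism of `Z∗`. The point is that this does not depend on `v` and loses no
information.

Since `u` is idempotent and lies in the closure of `F`, it is approximated by two words `a`, `b`
with `a ++ b ∈ F` (`exists_append_mem_mk_eq`). As `u` is forbidden in the closure of `Z`, the word
`a` is no factor of `Z`, so each occurrence of `a` in a word of `Z∗` contains a cut point of its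
factorization (`exists_cut_of_mem_kstar`).

For independence, take `v₁`, `v₂` of the same class in `HX`. Cutting `x a b v₁ a y ∈ Z∗` inside both
copies of `a` isolates a middle word `p b v₁ s'` of `Z∗`. Here `p b` is a suffix of `a b`, hence in
`F`, and is completable into `X∗` by maximality. Invertibility of the class of `v₁` makes the middle
word a prefix of a word of `X∗`, and a prefix that lies in `Z∗` then lies in `X∗`. There `v₁` may be
replaced by `v₂`, and the pieces are glued back. Injectivity is the same cutting argument with the
roles of `X` and `Z` exchanged. -/

theorem Language.append_mem_kstar {A : Type u} {L : Language A} {a b : List A}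
    (ha : a ∈ L∗) (hb : b ∈ L∗) : a ++ b ∈ L∗ := by
  obtain ⟨S, rfl, hS⟩ := ha
  obtain ⟨T, rfl, hT⟩ := hb
  refine ⟨S ++ T, by simp, ?_⟩
  intro y hy
  rcases List.mem_append.1 hy with hy | hy
  · exact hS y hy
  · exact hT y hy

theorem Language.kstar_subset {A : Type u} {K L : Language A} (h : K ≤ L) {a : List A}
    (ha : a ∈ K∗) : a ∈ L∗ := by
  obtain ⟨S, rfl, hS⟩ := ha
  exact ⟨S, rfl, fun y hy => h (hS y hy)⟩

theorem IsPrefixCode.eq_of_append_eq {A : Type u} {Z : Language A} (hZ : IsPrefixCode Z)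
    {s t a b : List A} (hs : s ∈ Z) (ht : t ∈ Z) (h : s ++ a = t ++ b) : s = t := by
  rcases List.append_eq_append_iff.1 h with ⟨r, h1, -⟩ | ⟨r, h1, -⟩
  · by_cases hr : r = []
    · simp [h1, hr]
    · exact absurd (h1 ▸ ht) (hZ.append_notMem s hs r hr)
  · by_cases hr : r = []
    · simp [h1, hr]
    · exact absurd (h1 ▸ hs) (hZ.append_notMem t ht r hr)

/-- Unique factorization over a prefix code, in the form used for prefixes: leading factors must
agree, and cancelling them one by one leaves a tail. -/
theorem IsPrefixCode.exists_eq_append_of_flatten {A : Type u} {Z : Language A}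
    (hZ : IsPrefixCode Z) (S : List (List A)) :
    ∀ (T : List (List A)) (b : List A), (∀ y ∈ S, y ∈ Z) → (∀ y ∈ T, y ∈ Z) →
      S.flatten ++ b = T.flatten → ∃ R, T = S ++ R ∧ b = R.flatten := by
  induction S with
  | nil => intro T b _ _ h; exact ⟨T, rfl, by simpa using h⟩
  | cons s S ih =>
    intro T b hS hT h
    have hs : s ∈ Z := hS s List.mem_cons_self
    cases T with
    | nil =>
      simp only [List.flatten_cons, List.flatten_nil, List.append_eq_nil_iff] at h
      exact absurd (h.1.1 ▸ hs) hZ.nil_notMem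
    | cons t T =>
      simp only [List.flatten_cons, List.append_assoc] at h
      obtain rfl := hZ.eq_of_append_eq hs (hT t List.mem_cons_self) h
      obtain ⟨R, rfl, hb⟩ := ih T b (fun y hy => hS y (List.mem_cons_of_mem _ hy))
        (fun y hy => hT y (List.mem_cons_of_mem _ hy)) (List.append_cancel_left h)
      exact ⟨R, rfl, hb⟩

/-- The submonoid generated by a prefix code is right unitary. -/
theorem IsPrefixCode.mem_kstar_of_append {A : Type u} {Z : Language A} (hZ : IsPrefixCode Z)
    {a b : List A} (ha : a ∈ Z∗) (hab : a ++ b ∈ Z∗) : b ∈ Z∗ := by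
  obtain ⟨S, rfl, hS⟩ := ha
  obtain ⟨T, hT, hT'⟩ := hab
  obtain ⟨R, rfl, rfl⟩ := hZ.exists_eq_append_of_flatten S T b hS hT' hT
  exact ⟨R, rfl, fun y hy => hT' y (List.mem_append_right _ hy)⟩

/-- The `Z`-factorization of `a` is an initial segment of that of `a ++ b`, whose factors all lie in
`X`. This is the device that brings words of `Z∗` back into `X∗`. -/
theorem IsPrefixCode.mem_kstar_of_append_mem_kstar {A : Type u} {X Z : Language A}
    (hZ : IsPrefixCode Z) (hXZ : X ≤ Z) {a b : List A} (ha : a ∈ Z∗) (hab : a ++ b ∈ X∗) :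
    a ∈ X∗ := by
  obtain ⟨S, rfl, hS⟩ := ha
  obtain ⟨T, hT, hT'⟩ := hab
  obtain ⟨R, rfl, rfl⟩ :=
    hZ.exists_eq_append_of_flatten S T b hS (fun y hy => hXZ (hT' y hy)) hT
  exact ⟨S, rfl, fun y hy => hT' y (List.mem_append_left _ hy)⟩

/-- A factorization of a word of `Z∗` cuts each of its factors that is not a factor of `Z`. -/
theorem Language.exists_cut_of_mem_kstar {A : Type u} {Z : Language A} {w : List A}
    (hw : ∀ x y : List A, x ++ w ++ y ∉ Z) {x y : List A} (h : x ++ w ++ y ∈ Z∗) :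
    ∃ s p : List A, w = s ++ p ∧ x ++ s ∈ Z∗ ∧ p ++ y ∈ Z∗ := by
  obtain ⟨S, h1, h2⟩ := h
  induction S generalizing x with
  | nil =>
    simp only [List.flatten_nil, List.append_eq_nil_iff] at h1
    obtain ⟨⟨rfl, rfl⟩, rfl⟩ := h1
    exact ⟨[], [], rfl, ⟨[], rfl, by simp⟩, ⟨[], rfl, by simp⟩⟩
  | cons t S ih =>
    have ht : t ∈ Z := h2 t List.mem_cons_self
    have hS : ∀ y ∈ S, y ∈ Z := fun y hy => h2 y (List.mem_cons_of_mem _ hy)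
    have ht' : t ∈ Z∗ := ⟨[t], by simp, by simpa using ht⟩
    rw [List.flatten_cons, List.append_assoc] at h1
    -- If `t` reaches the end of `x`, it cannot cover all of `w`, so it ends at a cut inside `w`;
    -- otherwise `t` is a prefix of `x` and the induction goes on.
    rcases List.append_eq_append_iff.1 h1 with ⟨r, h3, h4⟩ | ⟨r, h3, h4⟩
    · rcases List.append_eq_append_iff.1 h4 with ⟨q, h5, -⟩ | ⟨q, h5, h6⟩
      · exact absurd ht (by rw [h3, h5, ← List.append_assoc]; exact hw x q)
      · exact ⟨r, q, h5, h3 ▸ ht', S, h6.symm, hS⟩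
    · obtain ⟨s, p, h5, h6, h7⟩ := ih (x := r) (by rw [List.append_assoc]; exact h4.symm) hS
      refine ⟨s, p, h5, ?_, h7⟩
      rw [h3, List.append_assoc]
      exact Language.append_mem_kstar ht' h6

/-- A word of `F` is comparable, for the prefix order, with each `F`-maximal prefix code. -/
theorem IsMaximalPrefixCodeIn.exists_prefix {A : Type u} {F X : Language A}
    (hX : IsMaximalPrefixCodeIn F X) {t : List A} (ht : t ∈ F) (ht0 : t ≠ []) :
    ∃ x ∈ X, t <+: x ∨ x <+: t := by
  by_contra hc
  push Not at hc
  have hpre := hX.prop.1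
  -- Were `t` incomparable with every word of `X`, adjoining it would give a larger prefix code
  -- inside `F`.
  let Y : Language A := {w | w ∈ X ∨ w = t}
  have hY : IsPrefixCode Y := by
    refine ⟨⟨t, Or.inr rfl⟩, ?_, ?_⟩
    · rintro (h | h)
      · exact hpre.nil_notMem h
      · exact ht0 h.symm
    · rintro x (hx | rfl) w hw (h | h)
      · exact hpre.append_notMem x hx w hw h
      · exact (hc x hx).2 ⟨w, h⟩
      · exact (hc _ h).1 ⟨w, rfl⟩
      · exact hw (by simpa using h)
  have hYF : Y ≤ F := by
    rintro w (hw | rfl)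
    · exact hX.prop.2 hw
    · exact ht
  have htX : t ∈ X := hX.le_of_ge ⟨hY, hYF⟩ (fun w hw => Or.inl hw) (Or.inr rfl)
  exact (hc t htX).1 (List.prefix_refl t)

/-- A word of `F` is a prefix of a code word or begins with one; in the second case the remainder is
shorter and still in `F`, as `F` is factorial. -/
theorem IsMaximalPrefixCodeIn.exists_append_mem_kstar {A : Type u} {F X : Language A}
    (hF : IsFactorial F) (hX : IsMaximalPrefixCodeIn F X) (t : List A) (ht : t ∈ F) :
    ∃ y, t ++ y ∈ X∗ := by
  induction hn : t.length using Nat.strong_induction_on generalizing t with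
  | _ n ih =>
    subst hn
    by_cases ht0 : t = []
    · exact ⟨[], [], by simp [ht0], by simp⟩
    obtain ⟨x, hx, ⟨y, hy⟩ | ⟨r, rfl⟩⟩ := hX.exists_prefix ht ht0
    · exact ⟨y, [x], by simp [hy], by simpa using hx⟩
    · have hx0 : x ≠ [] := fun h => hX.prop.1.nil_notMem (h ▸ hx)
      obtain ⟨y, hy⟩ := ih r.length
        (by simpa using List.length_pos_iff.2 hx0) r
        (hF _ ht r (List.suffix_append x r).isInfix) rfl
      refine ⟨y, ?_⟩
      rw [List.append_assoc]
      exact Language.append_mem_kstar ⟨[x], by simp, by simpa using hx⟩ hy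

/-! ### Syntactic equality of words -/

theorem syntacticHom_eq_iff {A : Type u} {L : Language A} {u v : FreeMonoid A} :
    syntacticHom L u = syntacticHom L v ↔
      ∀ x y : List A, x ++ u.toList ++ y ∈ L ↔ x ++ v.toList ++ y ∈ L :=
  Con.eq (syntacticCon L)

theorem mem_of_syntacticHom_eq {A : Type u} {L : Language A} {u v : List A}
    (h : syntacticHom L (FreeMonoid.ofList u) = syntacticHom L (FreeMonoid.ofList v))
    {x y : List A} (hu : x ++ (u ++ y) ∈ L) : x ++ (v ++ y) ∈ L := by
  have := (syntacticHom_eq_iff.1 h x y).1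
  simp only [FreeMonoid.toList_ofList, List.append_assoc] at this
  exact this hu

/-- Words that agree in the syntactic monoid of `X∗` agree in that of `Z∗` once multiplied by words
close to the idempotent: one of the two inclusions of contexts. -/
theorem IsPrefixCode.mem_kstar_of_syntacticHom_eq {A : Type u} {F X Z : Language A}
    (hF : IsFactorial F) (hZ : IsPrefixCode Z) (hXZ : X ≤ Z) (hX : IsMaximalPrefixCodeIn F X)
    {a b v v₁ v₂ : List A} {e : SyntacticMonoid (X∗)} (ha : syntacticHom (X∗) (.ofList a) = e)
    (hb : syntacticHom (X∗) (.ofList b) = e) (hab : a ++ b ∈ F)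
    (haZ : ∀ x y : List A, x ++ a ++ y ∉ Z)
    (h12 : syntacticHom (X∗) (.ofList v₁) = syntacticHom (X∗) (.ofList v₂))
    (he : syntacticHom (X∗) (.ofList v₁) * e = syntacticHom (X∗) (.ofList v₁))
    (hv : syntacticHom (X∗) (.ofList v₁) * syntacticHom (X∗) (.ofList v) = e) (hee : e * e = e)
    {x y : List A} (h : x ++ (a ++ (b ++ (v₁ ++ (a ++ y)))) ∈ Z∗) :
    x ++ (a ++ (b ++ (v₂ ++ (a ++ y)))) ∈ Z∗ := by
  obtain ⟨s, p, hsp, h1, h2⟩ := Language.exists_cut_of_mem_kstar haZ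
    (x := x) (y := b ++ (v₁ ++ (a ++ y))) (by simpa using h)
  obtain ⟨s', p', hsp', h3, h4⟩ := Language.exists_cut_of_mem_kstar haZ
    (x := p ++ (b ++ v₁)) (y := y) (by simpa using h2)
  have hpF : p ++ b ∈ F := by
    refine hF _ hab _ (List.IsSuffix.isInfix ⟨s, ?_⟩)
    rw [hsp, List.append_assoc]
  obtain ⟨r, hr⟩ := hX.exists_append_mem_kstar hF _ hpF
  -- Both `b` and `b v₁ a v` have class `e` in `M(X∗)`, because `v` represents an inverse of the
  -- class of `v₁`.
  have h5 : p ++ ((b ++ (v₁ ++ (a ++ v))) ++ r) ∈ X∗ := by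
    refine mem_of_syntacticHom_eq (u := b) ?_ (by simpa using hr)
    simp only [FreeMonoid.ofList_append, map_mul, ha, hb]
    rw [← mul_assoc _ e, he, hv, hee]
  have h6 : p ++ (b ++ v₁) ++ s' ∈ X∗ := by
    refine hZ.mem_kstar_of_append_mem_kstar hXZ h3 (b := p' ++ (v ++ r)) ?_
    rw [hsp'] at h5
    simpa using h5
  have h7 : p ++ b ++ (v₂ ++ s') ∈ X∗ := mem_of_syntacticHom_eq h12 (by simpa using h6)
  have h8 := Language.append_mem_kstar h1
    (Language.append_mem_kstar (Language.kstar_subset hXZ h7) h4)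
  have h9 : x ++ ((s ++ p) ++ (b ++ (v₂ ++ ((s' ++ p') ++ y)))) ∈ Z∗ := by simpa using h8
  rwa [← hsp, ← hsp'] at h9

/-- Words that agree in the syntactic monoid of `Z∗` after multiplication by words close to the
idempotent agree in that of `X∗`: one of the two inclusions of contexts. -/
theorem IsPrefixCode.mem_kstar_of_syntacticHom_eq' {A : Type u} {X Z : Language A}
    (hZ : IsPrefixCode Z) (hXZ : X ≤ Z) (hX : IsPrefixCode X)
    {a b v v₁ v₂ : List A} {e : SyntacticMonoid (X∗)} (ha : syntacticHom (X∗) (.ofList a) = e)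
    (hb : syntacticHom (X∗) (.ofList b) = e) (haZ : ∀ x y : List A, x ++ a ++ y ∉ Z)
    (h12 : syntacticHom (Z∗) (.ofList (b ++ v₁ ++ b)) = syntacticHom (Z∗) (.ofList (b ++ v₂ ++ b)))
    (he₁ : e * syntacticHom (X∗) (.ofList v₁) = syntacticHom (X∗) (.ofList v₁))
    (he₁' : syntacticHom (X∗) (.ofList v₁) * e = syntacticHom (X∗) (.ofList v₁))
    (he₂ : e * syntacticHom (X∗) (.ofList v₂) = syntacticHom (X∗) (.ofList v₂))
    (he₂' : syntacticHom (X∗) (.ofList v₂) * e = syntacticHom (X∗) (.ofList v₂))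
    (hv : syntacticHom (X∗) (.ofList v₂) * syntacticHom (X∗) (.ofList v) = e) (hee : e * e = e)
    {x y : List A} (h : x ++ (v₁ ++ y) ∈ X∗) : x ++ (v₂ ++ y) ∈ X∗ := by
  have haX : ∀ x y : List A, x ++ a ++ y ∉ X := fun x y h => haZ x y (hXZ h)
  have h0 : x ++ ((a ++ (b ++ (v₁ ++ (b ++ a)))) ++ y) ∈ X∗ := by
    refine mem_of_syntacticHom_eq ?_ h
    simp only [FreeMonoid.ofList_append, map_mul, ha, hb]
    simp only [hee, he₁, he₁']
  -- Since `v₂ v` has class `e`, the word `v₂ v v₁` can stand for `v₁`. The result serves as the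
  -- word of `X∗` that makes `p b v₂ b s'`, known only to be in `Z∗`, a prefix of a word of `X∗`.
  have h0' : x ++ ((a ++ (b ++ (v₂ ++ (b ++ (a ++ (v ++ v₁)))))) ++ y) ∈ X∗ := by
    refine mem_of_syntacticHom_eq ?_ h
    simp only [FreeMonoid.ofList_append, map_mul, ha, hb]
    simp only [← mul_assoc, hee, he₂', hv, he₁]
  obtain ⟨s, p, hsp, h1, h2⟩ := Language.exists_cut_of_mem_kstar haX
    (x := x) (y := b ++ (v₁ ++ (b ++ (a ++ y)))) (by simpa using h0)
  obtain ⟨s', p', hsp', h3, h4⟩ := Language.exists_cut_of_mem_kstar haX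
    (x := p ++ (b ++ (v₁ ++ b))) (y := y) (by simpa using h2)
  have h5 : p ++ ((b ++ v₂ ++ b) ++ s') ∈ Z∗ :=
    mem_of_syntacticHom_eq h12 (by simpa using Language.kstar_subset hXZ h3)
  have h6 : p ++ ((b ++ v₂ ++ b) ++ s') ∈ X∗ := by
    refine hZ.mem_kstar_of_append_mem_kstar hXZ h5 (b := p' ++ (v ++ (v₁ ++ y))) ?_
    refine hX.mem_kstar_of_append h1 ?_
    have h7 : x ++ ((s ++ p) ++ (b ++ (v₂ ++ (b ++ ((s' ++ p') ++ (v ++ (v₁ ++ y))))))) ∈ X∗ := by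
      rw [← hsp, ← hsp']
      simpa using h0'
    simpa using h7
  have h8 := Language.append_mem_kstar h1 (Language.append_mem_kstar h6 h4)
  have h9 : x ++ ((s ++ p) ++ (b ++ (v₂ ++ (b ++ ((s' ++ p') ++ y))))) ∈ X∗ := by
    simpa using h8
  rw [← hsp, ← hsp'] at h9
  refine mem_of_syntacticHom_eq (u := a ++ (b ++ (v₂ ++ (b ++ a)))) ?_ (by simpa using h9)
  simp only [FreeMonoid.ofList_append, map_mul, ha, hb]
  simp only [hee, he₂, he₂']

/-! ### Maximal subgroups -/

/-- A group has only one idempotent, so `e` is its identity. -/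
theorem IsSubgroupOfMonoid.of_idempotent {M : Type u} [Monoid M] {S : Subsemigroup M}
    (hS : IsSubgroupOfMonoid S) {e : M} (he : e ∈ S) (hee : e * e = e) :
    (∀ x ∈ S, e * x = x ∧ x * e = x) ∧ ∀ x ∈ S, ∃ y ∈ S, x * y = e ∧ y * x = e := by
  obtain ⟨f, hf, h1, h2⟩ := hS
  have hef : e = f := by
    obtain ⟨y, hy, h3, -⟩ := h2 e he
    calc e = e * f := ((h1 e he).2).symm
      _ = e * (e * y) := by rw [h3]
      _ = f := by rw [← mul_assoc, hee, h3]
  subst hef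
  exact ⟨h1, h2⟩

/-- A maximal subgroup with identity `e` contains all units of the local monoid at `e`. -/
theorem IsMaximalSubgroup.mem_of_unit {M : Type u} [Monoid M] {S : Subsemigroup M}
    (hS : IsMaximalSubgroup S) {e : M} (he : e ∈ S) (hee : e * e = e) {x y : M}
    (hx : e * x = x ∧ x * e = x) (hy : e * y = y ∧ y * e = y) (hxy : x * y = e)
    (hyx : y * x = e) : x ∈ S := by
  let G : Subsemigroup M :=
    { carrier := {x | (e * x = x ∧ x * e = x) ∧ ∃ y, (e * y = y ∧ y * e = y) ∧
        x * y = e ∧ y * x = e}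
      mul_mem' := by
        rintro a b ⟨⟨a1, a2⟩, a', ⟨a3, a4⟩, a5, a6⟩ ⟨⟨b1, b2⟩, b', ⟨b3, b4⟩, b5, b6⟩
        refine ⟨⟨by rw [← mul_assoc, a1], by rw [mul_assoc, b2]⟩, b' * a',
          ⟨by rw [← mul_assoc, b3], by rw [mul_assoc, a4]⟩, ?_, ?_⟩
        · rw [mul_assoc, ← mul_assoc b, b5, a3, a5]
        · rw [mul_assoc, ← mul_assoc a', a6, b1, b6] }
  have hG : IsSubgroupOfMonoid G := by
    refine ⟨e, ⟨⟨hee, hee⟩, e, ⟨hee, hee⟩, hee, hee⟩, fun x hx => hx.1, ?_⟩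
    rintro x ⟨hx, y, hy, h3, h4⟩
    exact ⟨y, ⟨hy, x, hx, h4, h3⟩, h3, h4⟩
  obtain ⟨h1, h2⟩ := hS.prop.of_idempotent he hee
  have hSG : S ≤ G := by
    intro z hz
    obtain ⟨w, hw, h3, h4⟩ := h2 z hz
    exact ⟨h1 z hz, w, h1 w hw, h3, h4⟩
  exact hS.le_of_ge hG hSG ⟨hx, y, hy, hxy, hyx⟩

/-! ### Approximation of pseudowords by words -/

/-- The pairs of classes of the factorizations in two factors of a word. -/
def FinCon.pairs {A : Type u} (c : FinCon A) (w : FreeMonoid A) : Set (c.Quo × c.Quo) :=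
  {q | ∃ a b, w = a * b ∧ c.mk a = q.1 ∧ c.mk b = q.2}

theorem FinCon.mk_eq_of_pairs_eq {A : Type u} {c : FinCon A} {v w : FreeMonoid A}
    (h : c.pairs v = c.pairs w) : c.mk v = c.mk w := by
  have h1 : (1, c.mk v) ∈ c.pairs v := ⟨1, v, by simp, by simp, rfl⟩
  rw [h] at h1
  obtain ⟨a, b, rfl, h2, h3⟩ := h1
  rw [map_mul, h2, h3, one_mul]

/-- A cut of `v * w` falls in `v` or in `w`. Hence the pairs of a product are determined by the
pairs and classes of its factors, which makes `FinCon.pairsCon` a congruence. -/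
theorem FinCon.pairs_mul {A : Type u} (c : FinCon A) (v w : FreeMonoid A) :
    c.pairs (v * w) = (fun q => (q.1, q.2 * c.mk w)) '' c.pairs v ∪
      (fun q => (c.mk v * q.1, q.2)) '' c.pairs w := by
  ext ⟨m, n⟩
  constructor
  · rintro ⟨a, b, h, h1, h2⟩
    dsimp only at h1 h2
    rcases List.append_eq_append_iff.1
      (show FreeMonoid.toList v ++ w.toList = a.toList ++ b.toList from h) with
      ⟨r, h3, h4⟩ | ⟨r, h3, h4⟩
    · refine Or.inr ⟨(c.mk (.ofList r), n), ⟨.ofList r, b, h4, rfl, h2⟩, ?_⟩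
      dsimp only
      rw [← h1, ← map_mul]
      exact congrArg (fun t => (c.mk t, n)) (show v * FreeMonoid.ofList r = a from h3.symm)
    · refine Or.inl ⟨(m, c.mk (.ofList r)), ⟨a, .ofList r, h3, h1, rfl⟩, ?_⟩
      dsimp only
      rw [← h2, ← map_mul]
      exact congrArg (fun t => (m, c.mk t)) (show FreeMonoid.ofList r * w = b from h4.symm)
  · rintro (⟨q, ⟨a, b, rfl, h1, h2⟩, h3⟩ | ⟨q, ⟨a, b, rfl, h1, h2⟩, h3⟩)
    · cases h3
      exact ⟨a, b * w, by rw [mul_assoc], h1, by rw [map_mul, h2]⟩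
    · cases h3
      exact ⟨v * a, b, by rw [mul_assoc], by rw [map_mul, h1], h2⟩

/-- The congruence identifying words with the same pairs of classes of factors. -/
def FinCon.pairsCon {A : Type u} (c : FinCon A) : Con (FreeMonoid A) where
  r v w := c.pairs v = c.pairs w
  iseqv := ⟨fun _ => rfl, fun h => h.symm, fun h k => h.trans k⟩
  mul' := by
    intro v v' w w' hv hw
    rw [c.pairs_mul, c.pairs_mul, hv, hw, FinCon.mk_eq_of_pairs_eq hv,
      FinCon.mk_eq_of_pairs_eq hw]

/-- The congruence `FinCon.pairsCon`, as a congruence of finite index. -/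
def FinCon.square {A : Type u} (c : FinCon A) : FinCon A where
  val := c.pairsCon
  property := by
    refine Finite.of_injective (fun q : c.pairsCon.Quotient => c.pairs (Quotient.out q)) ?_
    intro p q hpq
    rw [← Quotient.out_eq p, ← Quotient.out_eq q]
    exact Quotient.sound hpq

theorem FinCon.mk_surjective {A : Type u} (c : FinCon A) : Function.Surjective c.mk :=
  Con.mk'_surjective

namespace FreeProfiniteMonoid

theorem exists_mem_mk_eq {A : Type u} {F : Language A} {u : FreeProfiniteMonoid A}
    (hu : u ∈ profiniteClosure F) (c : FinCon A) : ∃ w ∈ F, c.mk (.ofList w) = proj c u := by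
  obtain ⟨_, hv, w, hw, rfl⟩ := mem_closure_iff.1 hu (proj c ⁻¹' {proj c u})
    ((isOpen_discrete _).preimage (continuous_proj c)) rfl
  exact ⟨w, hw, hv⟩

/-- An idempotent in the closure of `F` is approximated by both halves of a word of `F`. -/
theorem exists_append_mem_mk_eq {A : Type u} {F : Language A} {u : FreeProfiniteMonoid A}
    (hu : u ∈ profiniteClosure F) (huu : u * u = u) (c : FinCon A) :
    ∃ a b : List A, a ++ b ∈ F ∧ c.mk (.ofList a) = proj c u ∧ c.mk (.ofList b) = proj c u := by
  obtain ⟨t, ht, htu⟩ := exists_mem_mk_eq hu c.square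
  obtain ⟨w, hw⟩ := c.square.mk_surjective (proj c.square u)
  have hle : c.square.1 ≤ c.1 := fun v w h => (Con.eq c.1).1 (FinCon.mk_eq_of_pairs_eq h)
  have hwc : c.mk w = proj c u := by
    have h1 := u.2 c.square c hle
    change FinCon.trans hle (proj c.square u) = proj c u at h1
    rw [← h1, ← hw]
    rfl
  -- Idempotence of `u` gives `t` the same pairs as `w * w`, so `t` inherits the cut of `w * w` in
  -- its middle.
  have h2 : c.square.mk (w * w) = c.square.mk (.ofList t) := by
    rw [htu, map_mul, hw, ← map_mul, huu]
  have h3 : c.pairs (w * w) = c.pairs (.ofList t) := (Con.eq c.square.1).1 h2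
  have h4 : (proj c u, proj c u) ∈ c.pairs (w * w) := ⟨w, w, rfl, hwc, hwc⟩
  rw [h3] at h4
  obtain ⟨a, b, h5, h6, h7⟩ := h4
  have h8 : t = a.toList ++ b.toList := h5
  exact ⟨a.toList, b.toList, h8 ▸ ht, h6, h7⟩

/-- The closure of a regular language is recognized by its syntactic congruence. -/
theorem mem_profiniteClosure_of_syntacticHat_eq {A : Type u} {L : Language A} (h : L.IsRegular)
    {u : FreeProfiniteMonoid A} {w : List A} (hw : w ∈ L)
    (hu : syntacticHat h u = syntacticHom L (.ofList w)) : u ∈ profiniteClosure L := by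
  have hopen : IsOpen (proj (syntacticFinCon h) ⁻¹' {proj (syntacticFinCon h) u}) :=
    (isOpen_discrete _).preimage (continuous_proj _)
  -- By density `u` is a limit of words of its own syntactic class, and all of these lie in `L`.
  refine closure_mono ?_ (denseRange_of.open_subset_closure_inter hopen (rfl : u ∈ _))
  rintro _ ⟨h1, v, rfl⟩
  refine ⟨v.toList, ?_, rfl⟩
  have h2 : syntacticHom L v = syntacticHom L (.ofList w) :=
    (show syntacticHom L v = syntacticHat h u from h1).trans hu
  have h3 := (syntacticHom_eq_iff.1 h2 [] []).2
  simp only [List.nil_append, List.append_nil, FreeMonoid.toList_ofList] at h3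
  exact h3 hw

end FreeProfiniteMonoid

/-- The intersection of two congruences of finite index. -/
def FinCon.inter {A : Type u} (c d : FinCon A) : FinCon A where
  val := Con.ker (c.mk.prod d.mk)
  property := Finite.of_injective (Con.kerLift _) (Con.kerLift_injective _)

theorem FinCon.inter_le_left {A : Type u} (c d : FinCon A) : (c.inter d).1 ≤ c.1 :=
  fun _ _ h => (Con.eq c.1).1 (congrArg Prod.fst (show (c.mk.prod d.mk) _ = _ from h))

theorem FinCon.inter_le_right {A : Type u} (c d : FinCon A) : (c.inter d).1 ≤ d.1 :=
  fun _ _ h => (Con.eq d.1).1 (congrArg Prod.snd (show (c.mk.prod d.mk) _ = _ from h))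

theorem syntacticHom_eq_syntacticHat {A : Type u} {L : Language A} (h : L.IsRegular)
    {c : FinCon A} (hc : c.1 ≤ syntacticCon L) {u : FreeProfiniteMonoid A} {w : FreeMonoid A}
    (hw : c.mk w = FreeProfiniteMonoid.proj c u) : syntacticHom L w = syntacticHat h u := by
  have h1 := u.2 c (syntacticFinCon h) hc
  change FinCon.trans (d := syntacticFinCon h) hc (FreeProfiniteMonoid.proj c u) = FreeProfiniteMonoid.proj _ u at h1
  change syntacticHom L w = FreeProfiniteMonoid.proj (syntacticFinCon h) u
  rw [← h1, ← hw]
  rfl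

/-! ### The embedding of `HX` into `HZ`. -/

theorem theoremt {A : Type u} [Finite A] (F Z X : Language A)
    (hF : IsFactorial F)
    (hZ : IsPrefixCode Z) (hZr : Z.IsRegular)
    (hX : X = Z ⊓ F) (hXr : X.IsRegular) (hXmax : IsMaximalPrefixCodeIn F X)
    (H : Subsemigroup (FreeProfiniteMonoid A)) (hH : IsMaximalSubgroup H)
    (hHF : (H : Set (FreeProfiniteMonoid A)) ⊆ profiniteClosure F)
    (hHZ : ∀ u ∈ H, IsForbiddenIn u (profiniteClosure Z))
    (HX : Subsemigroup (SyntacticMonoid (X∗))) (hHX : IsMaximalSubgroup HX)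
    (hXmap : ∀ u ∈ H, syntacticHat hXr.kstar' u ∈ HX)
    (HZ : Subsemigroup (SyntacticMonoid (Z∗))) (hHZ' : IsMaximalSubgroup HZ)
    (hZmap : ∀ u ∈ H, syntacticHat hZr.kstar' u ∈ HZ) :
    ∃ α : HX →ₙ* HZ, Function.Injective α ∧
      ∀ (u : FreeProfiniteMonoid A) (hu : u ∈ H),
        α ⟨syntacticHat hXr.kstar' u, hXmap u hu⟩ = ⟨syntacticHat hZr.kstar' u, hZmap u hu⟩ := by
  have hXZ : X ≤ Z := fun w hw => (hX ▸ hw : w ∈ Z ⊓ F).1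
  obtain ⟨u, huH, hu1, -⟩ := hH.prop
  have huu : u * u = u := (hu1 u huH).1
  -- The syntactic congruences of `X∗` and `Z∗` serve the two monoids; that of `Z` transfers
  -- forbiddenness from `u` to the word `a`.
  let c : FinCon A := ((syntacticFinCon hXr.kstar').inter (syntacticFinCon hZr.kstar')).inter
    (syntacticFinCon hZr)
  have hcX : c.1 ≤ syntacticCon (X∗) :=
    (FinCon.inter_le_left _ _).trans (FinCon.inter_le_left _ _)
  have hcZ : c.1 ≤ syntacticCon (Z∗) :=
    (FinCon.inter_le_left _ _).trans (FinCon.inter_le_right _ _)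
  have hcZ' : c.1 ≤ syntacticCon Z := FinCon.inter_le_right _ _
  obtain ⟨a, b, hab, ha, hb⟩ := FreeProfiniteMonoid.exists_append_mem_mk_eq (hHF huH) huu c
  have haX := syntacticHom_eq_syntacticHat hXr.kstar' hcX ha
  have hbX := syntacticHom_eq_syntacticHat hXr.kstar' hcX hb
  have haZ := syntacticHom_eq_syntacticHat hZr.kstar' hcZ ha
  have hbZ := syntacticHom_eq_syntacticHat hZr.kstar' hcZ hb
  have haZ' := syntacticHom_eq_syntacticHat hZr hcZ' ha
  have hfac : ∀ x y : List A, x ++ a ++ y ∉ Z := by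
    intro x y hxy
    refine hHZ u huH (.of (.ofList x)) (.of (.ofList y))
      (FreeProfiniteMonoid.mem_profiniteClosure_of_syntacticHat_eq hZr hxy ?_)
    simp only [map_mul, FreeMonoid.ofList_append, haZ']
    rfl
  set e := syntacticHat hXr.kstar' u with he
  set f := syntacticHat hZr.kstar' u with hf
  have heX : e ∈ HX := hXmap u huH
  have hfZ : f ∈ HZ := hZmap u huH
  have hee : e * e = e := by rw [he, ← map_mul, huu]
  have hff : f * f = f := by rw [hf, ← map_mul, huu]
  obtain ⟨hX1, hX2⟩ := hHX.prop.of_idempotent heX hee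
  obtain ⟨hZ1, -⟩ := hHZ'.prop.of_idempotent hfZ hff
  have hsurj : ∀ g : SyntacticMonoid (X∗), ∃ v : List A, syntacticHom (X∗) (.ofList v) = g :=
    fun g => (Con.mk'_surjective g : ∃ v : FreeMonoid A, syntacticHom (X∗) v = g)
  have hwd : ∀ v₁ v₂ : List A, syntacticHom (X∗) (.ofList v₁) ∈ HX →
      syntacticHom (X∗) (.ofList v₁) = syntacticHom (X∗) (.ofList v₂) →
      f * syntacticHom (Z∗) (.ofList v₁) * f = f * syntacticHom (Z∗) (.ofList v₂) * f := by
    intro v₁ v₂ hv₁ h12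
    obtain ⟨g, -, hg, -⟩ := hX2 _ hv₁
    obtain ⟨v, rfl⟩ := hsurj g
    have h1 : syntacticHom (Z∗) (.ofList (a ++ (b ++ (v₁ ++ a)))) =
        syntacticHom (Z∗) (.ofList (a ++ (b ++ (v₂ ++ a)))) := by
      refine syntacticHom_eq_iff.2 fun x y => ?_
      simp only [FreeMonoid.toList_ofList, List.append_assoc]
      exact ⟨hZ.mem_kstar_of_syntacticHom_eq hF hXZ hXmax haX hbX hab hfac h12
          (hX1 _ hv₁).2 hg hee,
        hZ.mem_kstar_of_syntacticHom_eq hF hXZ hXmax haX hbX hab hfac h12.symm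
          (hX1 _ (h12 ▸ hv₁)).2 (h12 ▸ hg) hee⟩
    simpa only [FreeMonoid.ofList_append, map_mul, haZ, hbZ, ← mul_assoc, hff] using h1
  have hinj : ∀ v₁ v₂ : List A, syntacticHom (X∗) (.ofList v₁) ∈ HX →
      syntacticHom (X∗) (.ofList v₂) ∈ HX →
      f * syntacticHom (Z∗) (.ofList v₁) * f = f * syntacticHom (Z∗) (.ofList v₂) * f →
      syntacticHom (X∗) (.ofList v₁) = syntacticHom (X∗) (.ofList v₂) := by
    intro v₁ v₂ hv₁ hv₂ h12
    obtain ⟨g₁, -, hg₁, -⟩ := hX2 _ hv₁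
    obtain ⟨w₁, rfl⟩ := hsurj g₁
    obtain ⟨g₂, -, hg₂, -⟩ := hX2 _ hv₂
    obtain ⟨w₂, rfl⟩ := hsurj g₂
    have h1 : syntacticHom (Z∗) (.ofList (b ++ v₁ ++ b)) =
        syntacticHom (Z∗) (.ofList (b ++ v₂ ++ b)) := by
      simpa only [FreeMonoid.ofList_append, map_mul, hbZ] using h12
    refine syntacticHom_eq_iff.2 fun x y => ?_
    simp only [FreeMonoid.toList_ofList, List.append_assoc]
    exact ⟨hZ.mem_kstar_of_syntacticHom_eq' hXZ hXmax.prop.1 haX hbX hfac h1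
        (hX1 _ hv₁).1 (hX1 _ hv₁).2 (hX1 _ hv₂).1 (hX1 _ hv₂).2 hg₂ hee,
      hZ.mem_kstar_of_syntacticHom_eq' hXZ hXmax.prop.1 haX hbX hfac h1.symm
        (hX1 _ hv₂).1 (hX1 _ hv₂).2 (hX1 _ hv₁).1 (hX1 _ hv₁).2 hg₁ hee⟩
  choose σ hσ using hsurj
  let φ : SyntacticMonoid (X∗) → SyntacticMonoid (Z∗) :=
    fun g => f * syntacticHom (Z∗) (.ofList (σ g)) * f
  have hφ : ∀ v : List A, syntacticHom (X∗) (.ofList v) ∈ HX →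
      φ (syntacticHom (X∗) (.ofList v)) = f * syntacticHom (Z∗) (.ofList v) * f :=
    fun v hv => hwd _ _ (by rwa [hσ]) (hσ _)
  have hφ1 : ∀ g, f * φ g = φ g ∧ φ g * f = φ g := fun g =>
    ⟨by simp only [φ, ← mul_assoc, hff], by simp only [φ, mul_assoc, hff]⟩
  have hφmul : ∀ g ∈ HX, ∀ k ∈ HX, φ (g * k) = φ g * φ k := by
    intro g hg k hk
    -- The word `b` is neutral between classes of `HX`, while in `M(Z∗)` it supplies the factor `f`
    -- needed between `φ g` and `φ k`.
    have h1 : syntacticHom (X∗) (.ofList (σ g ++ (b ++ σ k))) = g * k := by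
      simp only [FreeMonoid.ofList_append, map_mul, hσ, hbX, (hX1 k hk).1]
    have h2 := hφ (σ g ++ (b ++ σ k)) (h1 ▸ HX.mul_mem hg hk)
    rw [h1] at h2
    rw [h2]
    simp only [FreeMonoid.ofList_append, map_mul, hbZ, φ, ← mul_assoc]
    simp only [mul_assoc _ f f, hff]
  have hφhat : ∀ h ∈ H, φ (syntacticHat hXr.kstar' h) = syntacticHat hZr.kstar' h := by
    intro h hh
    obtain ⟨v, hv⟩ := c.mk_surjective (FreeProfiniteMonoid.proj c h)
    have hvX : syntacticHom (X∗) (.ofList v.toList) = _ :=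
      syntacticHom_eq_syntacticHat hXr.kstar' hcX hv
    have hvZ : syntacticHom (Z∗) (.ofList v.toList) = _ :=
      syntacticHom_eq_syntacticHat hZr.kstar' hcZ hv
    have h1 := hφ v.toList (hvX ▸ hXmap h hh)
    rw [hvX, hvZ, (hZ1 _ (hZmap h hh)).1, (hZ1 _ (hZmap h hh)).2] at h1
    exact h1
  have hφe : φ e = f := hφhat u huH
  have hmem : ∀ g ∈ HX, φ g ∈ HZ := by
    intro g hg
    obtain ⟨k, hk, h1, h2⟩ := hX2 g hg
    -- The image of the inverse of `g` is an inverse of `φ g` relative to `f`.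
    refine hHZ'.mem_of_unit hfZ hff (hφ1 g) (hφ1 k) ?_ ?_
    · rw [← hφmul g hg k hk, h1, hφe]
    · rw [← hφmul k hk g hg, h2, hφe]
  refine ⟨⟨fun g => ⟨φ g, hmem g g.2⟩, fun g k => Subtype.ext (hφmul g g.2 k k.2)⟩, ?_,
    fun h hh => Subtype.ext (hφhat h hh)⟩
  intro g k hgk
  have h1 : φ g = φ k := congrArg Subtype.val hgk
  have h2 := hinj (σ g) (σ k) (by rw [hσ]; exact g.2) (by rw [hσ]; exact k.2) h1
  rw [hσ, hσ] at h2
  exact Subtype.ext h2
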